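/- For a finite simple graph $G$ with vertex set $[n]=\{1,\dots,n\}$ and edge set $E$, the Gram dimension $\mathrm{gd}(G)$ is the smallest integer $k\ge 1$ such that for every real symmetric positive semidefinite $n\times n$ matrix $X$ there is a real symmetric positive semidefinite $n\times n$ matrix $X'$ of rank at most $k$ with $X'_{ii}=X_{ii}$ for all $i\in[n]$ and $X'_{ij}=X_{ij}$ for all edges $\{i,j\}\in E$. The graph parameter $\mathrm{gd}(G)$ is unbounded on the class of planar graphs: for every integer $k\ge 0$ there is a finite planar graph $G$ with $\mathrm{gd}(G)>k$. -/

import Mathlib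

/-- The `G`-partial matrices of `X` and `Y` coincide: the two matrices have the same entries on
the diagonal and at the positions of the edges of `G`. -/
def AgreeOnGraph {n : ℕ} (G : SimpleGraph (Fin n)) (X Y : Matrix (Fin n) (Fin n) ℝ) : Prop :=
  (∀ i, X i i = Y i i) ∧ ∀ i j, G.Adj i j → X i j = Y i j

/-- Every `G`-partial matrix that has a positive semidefinite completion `X` also has a
positive semidefinite completion of rank at most `k`. -/
def HasRankCompletions {n : ℕ} (G : SimpleGraph (Fin n)) (k : ℕ) : Prop :=
  ∀ X : Matrix (Fin n) (Fin n) ℝ, X.PosSemidef →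
    ∃ Y : Matrix (Fin n) (Fin n) ℝ, Y.PosSemidef ∧ Y.rank ≤ k ∧ AgreeOnGraph G X Y

/-- The Gram dimension of a graph: the smallest integer `k ≥ 1` with `HasRankCompletions G k`. -/
noncomputable def gramDim {n : ℕ} (G : SimpleGraph (Fin n)) : ℕ :=
  sInf {k : ℕ | 1 ≤ k ∧ HasRankCompletions G k}

/-- The minimum that defines `gramDim` is attained. -/
theorem gramDim_spec {n : ℕ} (G : SimpleGraph (Fin n)) :
    1 ≤ gramDim G ∧ HasRankCompletions G (gramDim G) :=
  Nat.sInf_mem (s := {k : ℕ | 1 ≤ k ∧ HasRankCompletions G k})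
    ⟨n + 1, by omega, fun X hX =>
      ⟨X, hX, (X.rank_le_width).trans (Nat.le_succ n), fun _ => rfl, fun _ _ _ => rfl⟩⟩

/-- A (simple) graph is planar if it can be drawn in the plane without crossings: the vertices
are sent to distinct points, every edge to a simple arc (the image of an injective continuous map
on `[0, 1]`) that joins the points of its two ends, the interior of an arc contains no vertex, and
the interiors of the arcs of two different edges are disjoint. -/
def IsPlanarGraph {V : Type*} (G : SimpleGraph V) : Prop :=
  ∃ (p : V → ℝ × ℝ) (γ : G.edgeSet → C(unitInterval, ℝ × ℝ)),
    Function.Injective p ∧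
    (∀ e, Function.Injective (γ e)) ∧
    (∀ e : G.edgeSet, ∃ u v : V, (e : Sym2 V) = s(u, v) ∧ γ e 0 = p u ∧ γ e 1 = p v) ∧
    (∀ e, ∀ t ∈ Set.Ioo (0 : unitInterval) 1, ∀ v, γ e t ≠ p v) ∧
    (∀ e f, e ≠ f → ∀ s ∈ Set.Ioo (0 : unitInterval) 1, ∀ t ∈ Set.Ioo (0 : unitInterval) 1,
      γ e s ≠ γ f t)

/-! Place the standard basis of ℝ^r on the bottom row of a triangular grid, and at each higher
vertex put the sum of the two vectors below it. Each relation lives on a triangle of edges, so it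
also holds in every completion `Y` (`Matrix.PosSemidef.row_eq_add`). Hence `Y - pascalGram r` obeys
Pascal's recursion in both arguments and vanishes on the diagonal, so it is zero
(`pascal_array_eq_zero`). The bottom row of `Y` then carries an identity block, which forces rank at
least `r`. -/

/-- A symmetric array on the triangular grid that obeys Pascal's recursion in each argument and
vanishes on the diagonal is zero. -/
theorem pascal_array_eq_zero {r : ℕ} (D : ℕ × ℕ → ℕ × ℕ → ℝ) (symm : ∀ a b, D a b = D b a)
    (pascal : ∀ d i b, d + 1 + i < r → D (d + 1, i) b = D (d, i) b + D (d, i + 1) b)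
    (diag : ∀ d i, d + i < r → D (d, i) (d, i) = 0) (m : ℕ) :
    ∀ s d i e j, s ≤ i → s ≤ j → d + i ≤ s + m → e + j ≤ s + m → s + m < r →
      D (d, i) (e, j) = 0 := by
  have pascal' : ∀ d i b, d + 1 + i < r → D b (d + 1, i) = D b (d, i) + D b (d, i + 1) := by
    intro d i b h
    rw [symm, pascal d i b h, symm b, symm b]
  -- The vertex `(d, i)` expands over the base interval `[i, i + d]`; the claim for `m` covers pairs
  -- whose intervals lie in one window `[s, s + m]`.
  induction m with
  | zero =>
    intro s d i e j h1 h2 h3 h4 h5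
    obtain rfl : d = 0 := by omega
    obtain rfl : e = 0 := by omega
    obtain rfl : i = j := by omega
    exact diag 0 i (by omega)
  | succ m ih =>
    have left : ∀ s a, a ≤ m → s + (m + 1) < r → D (a, s) (m, s + 1) = D (0, s) (m, s + 1) := by
      intro s a ha hs
      induction a with
      | zero => rfl
      | succ a iha =>
        rw [pascal a s _ (by omega), iha (by omega),
          ih (s + 1) a (s + 1) m (s + 1) le_rfl le_rfl (by omega) (by omega) (by omega), add_zero]
    have right : ∀ s b c, b ≤ m → c + b = s + (m + 1) → s + (m + 1) < r →
        D (0, s) (b, c) = D (0, s) (0, s + (m + 1)) := by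
      intro s b
      induction b with
      | zero =>
        intro c _ hc _
        rw [← hc, add_zero]
      | succ b ihb =>
        intro c hb hc hs
        rw [pascal' b c _ (by omega),
          ih s 0 s b c le_rfl (by omega) (by omega) (by omega) (by omega), zero_add,
          ihb (c + 1) (by omega) (by omega) hs]
    have ends : ∀ s, s + (m + 1) < r → D (0, s) (0, s + (m + 1)) = 0 := by
      intro s hs
      -- Expanding the apex of the window leaves twice the cross term, which `left` and `right`
      -- reduce to the one base entry not covered by the two smaller windows.
      have h := diag (m + 1) s (by omega)
      rw [pascal m s _ (by omega), pascal' m s _ (by omega), pascal' m s _ (by omega),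
        diag m s (by omega), diag m (s + 1) (by omega), symm (m, s + 1) (m, s),
        left s m le_rfl hs, right s m (s + 1) le_rfl (by omega) hs] at h
      linarith
    have base : ∀ s i j, s ≤ i → s ≤ j → i ≤ s + (m + 1) → j ≤ s + (m + 1) → s + (m + 1) < r →
        D (0, i) (0, j) = 0 := by
      intro s i j h1 h2 h3 h4 h5
      by_cases hl : s + 1 ≤ i ∧ s + 1 ≤ j
      · exact ih (s + 1) 0 i 0 j hl.1 hl.2 (by omega) (by omega) (by omega)
      by_cases hr : i ≤ s + m ∧ j ≤ s + m
      · exact ih s 0 i 0 j h1 h2 (by omega) (by omega) (by omega)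
      obtain ⟨rfl, rfl⟩ | ⟨rfl, rfl⟩ : (i = s ∧ j = s + (m + 1)) ∨ (j = s ∧ i = s + (m + 1)) := by
        omega
      · exact ends _ h5
      · rw [symm]
        exact ends _ h5
    have half : ∀ s d i j, s ≤ i → s ≤ j → d + i ≤ s + (m + 1) → j ≤ s + (m + 1) →
        s + (m + 1) < r → D (d, i) (0, j) = 0 := by
      intro s d
      induction d with
      | zero =>
        intro i j h1 h2 h3 h4 h5
        exact base s i j h1 h2 (by omega) h4 h5
      | succ d ihd =>
        intro i j h1 h2 h3 h4 h5
        rw [pascal d i _ (by omega), ihd i j h1 h2 (by omega) h4 h5,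
          ihd (i + 1) j (by omega) h2 (by omega) h4 h5, add_zero]
    intro s d i e
    induction e with
    | zero =>
      intro j h1 h2 h3 h4 h5
      exact half s d i j h1 h2 h3 (by omega) h5
    | succ e ihe =>
      intro j h1 h2 h3 h4 h5
      rw [pascal' e j _ (by omega), ihe j h1 h2 h3 (by omega) h5,
        ihe (j + 1) h1 (by omega) h3 (by omega) h5, add_zero]

/-- In a Gram matrix, a relation `a = b + c` among three vectors is detected by their pairwise
inner products. -/
theorem Matrix.PosSemidef.row_eq_add {n : Type*} [Fintype n] [DecidableEq n] {Y : Matrix n n ℝ}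
    (hY : Y.PosSemidef) {a b c : n}
    (h : Y a a + Y b b + Y c c - 2 * Y a b - 2 * Y a c + 2 * Y b c = 0) (z : n) :
    Y a z = Y b z + Y c z := by
  have symm : ∀ i j, Y i j = Y j i := fun i j => by simpa using hY.1.apply j i
  -- `h` says that the quadratic form of `Y` vanishes at `e_a - e_b - e_c`, so this vector lies in
  -- the kernel of `Y`.
  have key := (hY.dotProduct_mulVec_zero_iff
    (Pi.single a 1 - Pi.single b 1 - Pi.single c 1)).1 (by
      simp only [star_trivial, Matrix.mulVec_sub, sub_dotProduct, dotProduct_sub,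
        Matrix.mulVec_single_one, single_one_dotProduct, Matrix.col_apply]
      rw [symm b a, symm c a, symm c b]
      linarith)
  have hz := congrFun key z
  simp only [Matrix.mulVec_sub, Matrix.mulVec_single_one, Pi.sub_apply, Matrix.col_apply,
    Pi.zero_apply] at hz
  rw [symm a, symm b, symm c]
  linarith

/-- The directions of the edges of the triangular lattice, drawn in `ℤ × ℤ`. -/
def IsLatticeDir (v : ℤ × ℤ) : Prop :=
  v = (1, 0) ∨ v = (0, 1) ∨ v = (1, -1)

/-- The triangular lattice on `ℤ × ℤ`: the square lattice with one diagonal in every square. -/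
def triangularLattice : SimpleGraph (ℤ × ℤ) where
  Adj a b := IsLatticeDir (b - a) ∨ IsLatticeDir (a - b)
  symm := ⟨fun _ _ h => h.symm⟩
  loopless := ⟨fun a h => by simp [IsLatticeDir, Prod.ext_iff] at h⟩

theorem int_cast_ne_of_mem_Ioo {s : ℝ} (hs : s ∈ Set.Ioo (0 : ℝ) 1) (a b : ℤ) :
    (a : ℝ) + s ≠ b := by
  intro h
  have h1 : ((b - a : ℤ) : ℝ) = s := by push_cast; linarith
  have h2 : (0 : ℝ) < ((b - a : ℤ) : ℝ) := h1 ▸ hs.1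
  have h3 : ((b - a : ℤ) : ℝ) < 1 := h1 ▸ hs.2
  norm_cast at h2 h3
  omega

theorem int_cast_add_inj {s t : ℝ} (hs : s ∈ Set.Ioo (0 : ℝ) 1) (ht : t ∈ Set.Ioo (0 : ℝ) 1)
    {a b : ℤ} (h : (a : ℝ) + s = b + t) : a = b := by
  have h1 : ((b - a : ℤ) : ℝ) = s - t := by push_cast; linarith
  have h2 : ((b - a : ℤ) : ℝ) < 1 := by rw [h1]; linarith [hs.2, ht.1]
  have h3 : (-1 : ℝ) < ((b - a : ℤ) : ℝ) := by rw [h1]; linarith [hs.1, ht.2]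
  norm_cast at h2 h3
  omega

theorem lattice_edge_ne_vertex {s : ℝ} (hs : s ∈ Set.Ioo (0 : ℝ) 1) {δ : ℤ × ℤ}
    (hδ : IsLatticeDir δ) (a b : ℤ × ℤ)
    (h1 : (a.1 : ℝ) + s * δ.1 = b.1) (h2 : (a.2 : ℝ) + s * δ.2 = b.2) : False := by
  rcases hδ with rfl | rfl | rfl <;> simp at h1 h2
  · exact int_cast_ne_of_mem_Ioo hs _ _ h1
  · exact int_cast_ne_of_mem_Ioo hs _ _ h2
  · exact int_cast_ne_of_mem_Ioo hs _ _ h1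

/-- Which coordinates of an interior point are integers determines the direction of its edge;
integer parts then determine the starting point. -/
theorem lattice_edge_inj {s t : ℝ} (hs : s ∈ Set.Ioo (0 : ℝ) 1) (ht : t ∈ Set.Ioo (0 : ℝ) 1)
    {δ ε : ℤ × ℤ} (hδ : IsLatticeDir δ) (hε : IsLatticeDir ε) {a b : ℤ × ℤ}
    (h1 : (a.1 : ℝ) + s * δ.1 = b.1 + t * ε.1) (h2 : (a.2 : ℝ) + s * δ.2 = b.2 + t * ε.2) :
    a = b ∧ δ = ε := by
  rcases hδ with rfl | rfl | rfl <;> rcases hε with rfl | rfl | rfl <;> simp at h1 h2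
  · exact ⟨Prod.ext (int_cast_add_inj hs ht h1) h2, rfl⟩
  · exact (int_cast_ne_of_mem_Ioo hs _ _ h1).elim
  · exact (int_cast_ne_of_mem_Ioo ht a.2 b.2 (by linarith)).elim
  · exact (int_cast_ne_of_mem_Ioo hs _ _ h2).elim
  · exact ⟨Prod.ext h1 (int_cast_add_inj hs ht h2), rfl⟩
  · exact (int_cast_ne_of_mem_Ioo ht _ _ h1.symm).elim
  · exact (int_cast_ne_of_mem_Ioo hs b.2 a.2 (by linarith)).elim
  · exact (int_cast_ne_of_mem_Ioo hs _ _ h1).elim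
  · exact ⟨Prod.ext (int_cast_add_inj hs ht h1)
      (int_cast_add_inj ht hs (by linarith)), rfl⟩

/-- The straight segment from `a` to `b` in the plane, as a path. -/
noncomputable def latticeSegment (a b : ℤ × ℤ) : C(unitInterval, ℝ × ℝ) where
  toFun t := ((a.1 : ℝ) + t * ((b - a).1 : ℤ), (a.2 : ℝ) + t * ((b - a).2 : ℤ))
  continuous_toFun := by fun_prop

/-- Finite pieces of the triangular lattice are planar. -/
theorem isPlanarGraph_comap_triangularLattice {V : Type*} (q : V → ℤ × ℤ)
    (hq : Function.Injective q) : IsPlanarGraph (triangularLattice.comap q) := by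
  have orient : ∀ e : (triangularLattice.comap q).edgeSet,
      ∃ u v : V, (e : Sym2 V) = s(u, v) ∧ IsLatticeDir (q v - q u) := by
    rintro ⟨e, he⟩
    induction e using Sym2.ind with
    | _ u v =>
      rcases he with h | h
      · exact ⟨u, v, rfl, h⟩
      · exact ⟨v, u, Sym2.eq_swap, h⟩
  choose u v huv hdir using orient
  have mem : ∀ t ∈ Set.Ioo (0 : unitInterval) 1, (t : ℝ) ∈ Set.Ioo (0 : ℝ) 1 :=
    fun t ht => ⟨ht.1, ht.2⟩
  refine ⟨fun w => ((q w).1, (q w).2), fun e => latticeSegment (q (u e)) (q (v e)),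
    ?_, ?_, ?_, ?_, ?_⟩
  · intro a b h
    simp only [Prod.mk.injEq, Int.cast_inj] at h
    exact hq (Prod.ext h.1 h.2)
  · intro e s t h
    obtain ⟨h1, h2⟩ := Prod.mk.inj h
    apply Subtype.ext
    rcases hdir e with h' | h' | h' <;> rw [h'] at h1 h2 <;> simp at h1 h2 <;>
      first | exact h1 | exact h2
  · intro e
    refine ⟨u e, v e, huv e, ?_, ?_⟩ <;> simp [latticeSegment]
  · intro e t ht w h
    obtain ⟨h1, h2⟩ := Prod.mk.inj h
    exact lattice_edge_ne_vertex (mem t ht) (hdir e) _ _ h1 h2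
  · intro e f hef s hs t ht h
    obtain ⟨h1, h2⟩ := Prod.mk.inj h
    obtain ⟨ha, hb⟩ := lattice_edge_inj (mem s hs) (mem t ht) (hdir e) (hdir f) h1 h2
    have hu := hq ha
    have hv : v e = v f := hq (by rw [ha] at hb; exact sub_left_injective hb)
    exact hef (Subtype.ext (by rw [huv e, huv f, hu, hv]))

/-- The vectors of the triangular grid: the standard basis in row `0`, and each vector of a later
row the sum of the two below it. -/
def pascalVec (r : ℕ) : ℕ → ℕ → Fin r → ℝ
  | 0, i => fun l => if (l : ℕ) = i then 1 else 0
  | d + 1, i => pascalVec r d i + pascalVec r d (i + 1)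

/-- The position in the lattice of a vertex of the square grid with `r` rows. -/
def gridPos (r : ℕ) (a : Fin (r * r)) : ℤ × ℤ :=
  (((finProdFinEquiv.symm a).2 : ℕ), ((finProdFinEquiv.symm a).1 : ℕ))

theorem gridPos_injective (r : ℕ) : Function.Injective (gridPos r) := by
  intro a b h
  simp only [gridPos, Prod.mk.injEq, Nat.cast_inj] at h
  exact finProdFinEquiv.symm.injective (Prod.ext (Fin.ext h.2) (Fin.ext h.1))

/-- The `r × r` piece of the triangular lattice. -/
def triangularGrid (r : ℕ) : SimpleGraph (Fin (r * r)) :=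
  triangularLattice.comap (gridPos r)

/-- The Gram matrix of the vectors `pascalVec`. -/
def pascalGram (r : ℕ) : Matrix (Fin (r * r)) (Fin (r * r)) ℝ :=
  let W : Matrix (Fin (r * r)) (Fin r) ℝ := Matrix.of fun a =>
    pascalVec r (finProdFinEquiv.symm a).1 (finProdFinEquiv.symm a).2
  W * W.conjTranspose

theorem pascalGram_posSemidef (r : ℕ) : (pascalGram r).PosSemidef :=
  Matrix.posSemidef_self_mul_conjTranspose _

theorem pascalGram_apply (r : ℕ) (a b : Fin (r * r)) :
    pascalGram r a b = pascalVec r (finProdFinEquiv.symm a).1 (finProdFinEquiv.symm a).2 ⬝ᵥ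
      pascalVec r (finProdFinEquiv.symm b).1 (finProdFinEquiv.symm b).2 := by
  simp [pascalGram, Matrix.mul_apply, dotProduct]

/-- Every positive semidefinite matrix that agrees with `pascalGram` on the triangular grid has
an identity block on the bottom row. -/
theorem rank_le_of_agreeOnGraph_pascalGram {r : ℕ} [NeZero r]
    {Y : Matrix (Fin (r * r)) (Fin (r * r)) ℝ} (hY : Y.PosSemidef)
    (h : AgreeOnGraph (triangularGrid r) (pascalGram r) Y) : r ≤ Y.rank := by
  have hr : 0 < r := NeZero.pos r
  -- `Fin.ofNat` wraps modulo `r`; the Pascal relations are used only for `d + 1 + i < r`, where no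
  -- wrapping occurs.
  let idx : ℕ × ℕ → Fin (r * r) := fun x => finProdFinEquiv (Fin.ofNat r x.1, Fin.ofNat r x.2)
  have hX : ∀ d i e j, d < r → i < r → e < r → j < r → pascalGram r (idx (d, i)) (idx (e, j)) =
      pascalVec r d i ⬝ᵥ pascalVec r e j := by
    intro d i e j h1 h2 h3 h4
    simp [pascalGram_apply, idx, Nat.mod_eq_of_lt, *]
  have pos : ∀ d i, d < r → i < r → gridPos r (idx (d, i)) = ((i : ℤ), (d : ℤ)) := by
    intro d i h1 h2
    simp [gridPos, idx, Nat.mod_eq_of_lt, *]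
  have adj : ∀ d i e j, d < r → i < r → e < r → j < r →
      IsLatticeDir ((j : ℤ) - i, (e : ℤ) - d) →
      (triangularGrid r).Adj (idx (d, i)) (idx (e, j)) := by
    intro d i e j h1 h2 h3 h4 h5
    rw [triangularGrid, SimpleGraph.comap_adj, pos d i h1 h2, pos e j h3 h4]
    exact Or.inl h5
  have relX : ∀ d i, d + 1 + i < r → ∀ z, pascalGram r (idx (d + 1, i)) z =
      pascalGram r (idx (d, i)) z + pascalGram r (idx (d, i + 1)) z := by
    intro d i hd z
    have e1 : (d + 1) % r = d + 1 := Nat.mod_eq_of_lt (by omega)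
    have e2 : d % r = d := Nat.mod_eq_of_lt (by omega)
    have e3 : (i + 1) % r = i + 1 := Nat.mod_eq_of_lt (by omega)
    have e4 : i % r = i := Nat.mod_eq_of_lt (by omega)
    simp only [pascalGram_apply, idx, Equiv.symm_apply_apply, Fin.val_ofNat, e1, e2, e3, e4]
    rw [pascalVec, add_dotProduct]
  have symmX : ∀ a b, pascalGram r a b = pascalGram r b a := fun a b => by
    simpa using (pascalGram_posSemidef r).1.apply b a
  have symmY : ∀ a b, Y a b = Y b a := fun a b => by simpa using hY.1.apply b a
  have relY : ∀ d i, d + 1 + i < r → ∀ z, Y (idx (d + 1, i)) z =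
      Y (idx (d, i)) z + Y (idx (d, i + 1)) z := by
    intro d i hd z
    apply hY.row_eq_add
    rw [symmY (idx (d + 1, i)) (idx (d, i)), ← h.1, ← h.1, ← h.1,
      ← h.2 _ _ (adj d i (d + 1) i (by omega) (by omega) (by omega) (by omega)
        (by simp [IsLatticeDir])),
      ← h.2 _ _ (adj (d + 1) i d (i + 1) (by omega) (by omega) (by omega) (by omega)
        (by simp [IsLatticeDir])),
      ← h.2 _ _ (adj d i d (i + 1) (by omega) (by omega) (by omega) (by omega)
        (by simp [IsLatticeDir]))]
    have ha := relX d i hd (idx (d + 1, i))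
    have hb := relX d i hd (idx (d, i))
    have hc := relX d i hd (idx (d, i + 1))
    rw [symmX (idx (d, i + 1)) (idx (d + 1, i))] at ha
    rw [symmX (idx (d + 1, i)) (idx (d, i)), symmX (idx (d, i + 1)) (idx (d, i))] at hb
    linarith
  have agree : ∀ i j, i < r → j < r →
      Y (idx (0, i)) (idx (0, j)) = pascalGram r (idx (0, i)) (idx (0, j)) := by
    intro i j hi hj
    -- The window `s = 0`, `m = r - 1` is the whole bottom row.
    refine sub_eq_zero.1 (pascal_array_eq_zero (r := r)
      (fun a b => Y (idx a) (idx b) - pascalGram r (idx a) (idx b)) ?_ ?_ ?_ (r - 1) 0 0 i 0 j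
      (by omega) (by omega) (by omega) (by omega) (by omega))
    · intro a b
      rw [symmY (idx a), symmX (idx a)]
    · intro d i b hd
      simp only [relX d i hd, relY d i hd]
      ring
    · intro d i _
      simp only [h.1, sub_self]
  have block : Y.submatrix (fun i : Fin r => idx (0, i)) (fun i : Fin r => idx (0, i)) = 1 := by
    ext i j
    rw [Matrix.submatrix_apply, agree i j i.2 j.2, hX 0 i 0 j (by omega) i.2 (by omega) j.2]
    simp [pascalVec, dotProduct, Matrix.one_apply, Fin.val_inj, eq_comm]
  calc r = (1 : Matrix (Fin r) (Fin r) ℝ).rank := by simp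
    _ ≤ Y.rank := by rw [← block]; exact Matrix.rank_submatrix_le _ _ _

theorem corollary2p16 :
    ∀ k : ℕ, ∃ (n : ℕ) (G : SimpleGraph (Fin n)), IsPlanarGraph G ∧ k < gramDim G := by
  intro k
  refine ⟨(k + 1) * (k + 1), triangularGrid (k + 1),
    isPlanarGraph_comap_triangularLattice _ (gridPos_injective _), ?_⟩
  obtain ⟨Y, hY, hrank, hagree⟩ :=
    (gramDim_spec (triangularGrid (k + 1))).2 _ (pascalGram_posSemidef (k + 1))
  exact (rank_le_of_agreeOnGraph_pascalGram hY hagree).trans hrank
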